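/- Let $T$ be a metric space and let $(T,\mathcal A,\mu)$ be a complete $\sigma$-finite measure space with $\mathcal B(T)\subset\mathcal A$ such that $\mu$ is inner regular: for every $\varepsilon>0$ and every $B\in\mathcal A$ with $\mu(B)<\infty$ there is a compact $K\subset B$ with $\mu(B\setminus K)<\varepsilon$. Let $X$ be a real Banach space (not necessarily separable). For $g\colon X\to\overline{\mathbb R}=[-\infty,+\infty]$ put $\operatorname{epi} g=\{(x,\alpha)\in X\times\mathbb R: g(x)\le\alpha\}$. A family $(f^i)_{i\in I}$ of functions $f^i\colon T\times X\to\overline{\mathbb R}$ is a *uniform Lusin family* if for every $\varepsilon>0$ and every $A\in\mathcal A$ of finite measure there is a compact set $B\subset A$ with $\mu(A\setminus B)<\varepsilon$ such that, for all $i\in I$, the multifunction $B\ni t\mapsto\operatorname{epi} f^i_t$ is lower semicontinuous. A function $f\colon T\times X\to\overline{\mathbb R}$ is an *admissible integrand* if there is a uniform Lusin family $(f^i)_{i\in I}$ such that every $f^i_t$ is convex and lower semicontinuous (possibly improper) and $\operatorname{epi} f_t=\overline{\operatorname{epi}(\inf_{i\in I}f^i_t)}$ for all $t\in T$. A set $\mathcal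 L$ of strongly measurable functions $x\colon T\to X$ is *decomposable* if for every $x\in\mathcal L$, every strongly measurable $y\colon T\to X$ with compact range and every $A\in\mathcal A$ of finite measure one has $x\mathbb 1_{A^c}+y\mathbb 1_A\in\mathcal L$. For strongly measurable $x\colon T\to X$ put $$I_f(x)=\int_T f_t(x(t))\,d\mu:=\int_T\max\{f_t(x(t)),0\}\,d\mu+\int_T\min\{f_t(x(t)),0\}\,d\mu,\qquad (+\infty)+(-\infty):=+\infty .$$ Let $f$ be an admissible integrand and let $\mathcal L$ be decomposable with $I_f(u)<+\infty$ for some $u\in\mathcal L$. Let $\bar x\in\mathcal L$. 1. If $\bar x(t)\in\operatorname{argmin}_{x\in X}f_t(x)$ for almost all $t\in T$, then $\bar x$ minimizes $I_f$ over $\mathcal L$, that is, $I_f(\bar x)\le I_f(x)$ for all $x\in\mathcal L$. 2. If $I_f(\bar x)>-\infty$, then $\bar x$ minimizes $I_f$ over $\mathcal L$ if and only if $\bar x(t)\in\operatorname{argmin}_{x\in X}f_t(x)$ for almost all $t\in T$. Here $x\in\operatorname{argmin}_{X} f_t$ means $f_t(x)\le f_t(y)$ for all $y\in X$. -/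

import Mathlib

open Set MeasureTheory
open scoped ENNReal

namespace IntegralFunctional

/-- The epigraph `{(x, α) ∈ X × ℝ | g x ≤ α}` of an extended-real-valued function. -/
def epi {X : Type*} (g : X → EReal) : Set (X × ℝ) :=
  {p | g p.1 ≤ (p.2 : EReal)}

/-- Convex and lower semicontinuous extended-real-valued functions; convexity means convexity of
the epigraph, and the constant `+∞` is allowed. -/
def IsConvexLsc {X : Type*} [NormedAddCommGroup X] [NormedSpace ℝ X] (g : X → EReal) : Prop :=
  Convex ℝ (epi g) ∧ LowerSemicontinuous g

/-- A family of integrands is a uniform Lusin family if every measurable `A` of finite measure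
contains, up to an arbitrarily small measure, a compact set `B` on which all the epigraph
multifunctions `B ∋ t ↦ epi (fⁱ t)` are lower semicontinuous. -/
def IsUniformLusinFamily {T X ι : Type*} [TopologicalSpace T] [MeasurableSpace T]
    [TopologicalSpace X] (μ : Measure T) (f : ι → T → X → EReal) : Prop :=
  ∀ ε : ℝ≥0∞, 0 < ε → ∀ A : Set T, MeasurableSet A → μ A < ∞ →
    ∃ B : Set T, IsCompact B ∧ B ⊆ A ∧ μ (A \ B) < ε ∧
      ∀ i, LowerHemicontinuousOn (fun t => epi (f i t)) B

/-- Admissible integrands: `epi f_t` is the closure of `epi (inf_i fⁱ_t)` for some uniform Lusin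
family of functions `fⁱ` that are convex and lower semicontinuous in `x`. Both conditions on the
family depend only on the set of its members, so the family is indexed by that set, of any
cardinality. -/
def IsAdmissibleIntegrand {T X : Type*} [TopologicalSpace T] [MeasurableSpace T]
    [NormedAddCommGroup X] [NormedSpace ℝ X] (μ : Measure T) (f : T → X → EReal) : Prop :=
  ∃ F : Set (T → X → EReal),
    IsUniformLusinFamily μ (fun φ : F => (φ : T → X → EReal)) ∧
    (∀ φ ∈ F, ∀ t, IsConvexLsc (φ t)) ∧
    ∀ t, epi (f t) = closure (epi fun x => ⨅ φ : F, (φ : T → X → EReal) t x)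

open Classical in
/-- The upper integral `∫ max(g, 0) dμ + ∫ min(g, 0) dμ` with `(+∞) + (-∞) = +∞`. -/
noncomputable def upperIntegral {T : Type*} [MeasurableSpace T] (μ : Measure T)
    (g : T → EReal) : EReal :=
  if ∫⁻ t, (g t).toENNReal ∂μ = ∞ then ⊤
  else ((∫⁻ t, (g t).toENNReal ∂μ : ℝ≥0∞) : EReal)
    - ((∫⁻ t, (-g t).toENNReal ∂μ : ℝ≥0∞) : EReal)

/-- The integral functional `I_f(x) = ∫ f_t(x(t)) dμ`. -/
noncomputable def integralFunctional {T X : Type*} [MeasurableSpace T] (μ : Measure T)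
    (f : T → X → EReal) (x : T → X) : EReal :=
  upperIntegral μ fun t => f t (x t)

/-- Decomposable sets of strongly measurable functions: they contain `x 1_{Aᶜ} + y 1_A` whenever
they contain `x`, `y` is strongly measurable with compact range and `A` has finite measure. -/
structure IsDecomposable {T X : Type*} [MeasurableSpace T] [NormedAddCommGroup X]
    (μ : Measure T) (L : Set (T → X)) : Prop where
  stronglyMeasurable : ∀ x ∈ L, StronglyMeasurable x
  mem : ∀ x ∈ L, ∀ y : T → X, StronglyMeasurable y → IsCompact (range y) →
    ∀ A : Set T, MeasurableSet A → μ A < ∞ → Aᶜ.indicator x + A.indicator y ∈ L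

end IntegralFunctional

/-! Sufficiency is monotonicity of the upper integral. For necessity, the value at `xbar` is finite:
it exceeds `⊥` by assumption and is at most the value at `u`. Suppose `xbar` fails to be a pointwise
minimizer on a non-null set. Then for some rational `q` a non-null compact set `C` consists of
points with `inf f_t < q < f_t (xbar t)`. Since `f_t` itself need not be convex, one works locally:
near each `t₀ ∈ C` a single convex member `φ` of the Lusin family takes values below `q`, and
Michael's theorem gives a continuous `y` with `φ_t (y t) ≤ q` on a compact `K`, a neighbourhood of
`t₀` in `C`. Replacing `xbar` by `y` on `K` stays in `L` and strictly lowers the integrand there, so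
optimality forces `μ K = 0`. A compact set that is locally null is null, a contradiction; this
locality makes countability of the family unnecessary. -/

namespace IntegralFunctional

open Filter Topology Metric

/-! ### Continuous selections -/

section Selection

variable {Y E : Type*} [TopologicalSpace Y] [NormalSpace Y] [ParacompactSpace Y]
  [NormedAddCommGroup E] [NormedSpace ℝ E]

/-- A lower hemicontinuous multifunction with nonempty convex values has continuous approximate
selections. -/
theorem exists_continuous_forall_mem_thickening {G : Y → Set E} (hG : LowerHemicontinuous G)
    (hconv : ∀ y, Convex ℝ (G y)) (hne : ∀ y, (G y).Nonempty) {δ : ℝ} (hδ : 0 < δ) :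
    ∃ g : C(Y, E), ∀ y, g y ∈ thickening δ (G y) := by
  refine exists_continuous_forall_mem_convex_of_local_const
    (fun y => (hconv y).thickening δ) fun y => ?_
  obtain ⟨z, hz⟩ := hne y
  refine ⟨z, ?_⟩
  filter_upwards [lowerHemicontinuousAt_iff.1 (hG y) (ball z δ) isOpen_ball
    ⟨z, hz, mem_ball_self hδ⟩] with x ⟨w, hw, hwz⟩
  exact mem_thickening_iff.2 ⟨w, hw, by rwa [dist_comm]⟩

/-- **Michael's selection theorem**: a lower hemicontinuous multifunction on a paracompact space
with nonempty convex values in a Banach space has a continuous selection of its closure. -/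
theorem exists_continuous_forall_mem_closure [CompleteSpace E] {G : Y → Set E}
    (hG : LowerHemicontinuous G) (hconv : ∀ y, Convex ℝ (G y)) (hne : ∀ y, (G y).Nonempty) :
    ∃ g : C(Y, E), ∀ y, g y ∈ closure (G y) := by
  have step : ∀ (n : ℕ) (g : C(Y, E)), (∀ y, g y ∈ thickening ((1 / 2) ^ n) (G y)) →
      ∃ g' : C(Y, E), (∀ y, g' y ∈ thickening ((1 / 2) ^ (n + 1)) (G y)) ∧
        ∀ y, dist (g y) (g' y) ≤ 4 / 2 / 2 ^ n := by
    intro n g hg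
    -- Cutting `G y` with a ball around `g y` keeps the next approximation close to `g`; lower
    -- hemicontinuity survives because the ball has open graph.
    have hopen : LowerHemicontinuous fun y => G y ∩ ball (g y) ((1 / 2) ^ n) :=
      hG.inter_hasOpenCGraph (isOpen_lt (f := fun p : Y × E => dist p.2 (g p.1))
        (by fun_prop) continuous_const)
    obtain ⟨g', hg'⟩ := exists_continuous_forall_mem_thickening hopen
      (fun y => (hconv y).inter (convex_ball _ _)) (fun y => by
        obtain ⟨w, hw, hwd⟩ := mem_thickening_iff.1 (hg y)
        exact ⟨w, hw, by rwa [mem_ball, dist_comm]⟩) (δ := (1 / 2) ^ (n + 1)) (by positivity)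
    refine ⟨g', fun y => thickening_subset_of_subset _ inter_subset_left (hg' y), fun y => ?_⟩
    obtain ⟨w, ⟨-, hw⟩, hwd⟩ := mem_thickening_iff.1 (hg' y)
    have h1 : dist (g y) w < (1 / 2) ^ n := by rw [dist_comm]; exact hw
    have h2 : dist (g y) (g' y) ≤ dist (g y) w + dist (g' y) w := dist_triangle_right _ _ _
    -- The true distance is below `(1/2)^n + (1/2)^(n+1)`; the constant `4 / 2 / 2 ^ n` is a larger
    -- bound in the shape required by the geometric Cauchy criterion.
    have h3 : (4 / 2 / 2 ^ n : ℝ) = 2 * (1 / 2) ^ n := by rw [one_div, inv_pow]; ring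
    have h4 : (0 : ℝ) < (1 / 2) ^ n := by positivity
    rw [pow_succ] at hwd
    linarith
  choose! F hF hFd using step
  obtain ⟨g0, hg0⟩ := exists_continuous_forall_mem_thickening hG hconv hne (δ := (1 / 2) ^ 0)
    (by positivity)
  let s : ℕ → C(Y, E) := fun n => Nat.rec g0 F n
  have hs : ∀ n y, s n y ∈ thickening ((1 / 2) ^ n) (G y) := by
    intro n
    induction n with
    | zero => exact hg0
    | succ n ih => exact hF n (s n) ih
  have hsd : ∀ n y, dist (s n y) (s (n + 1) y) ≤ 4 / 2 / 2 ^ n := fun n => hFd n (s n) (hs n)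
  choose g hg using fun y =>
    cauchySeq_tendsto_of_complete (cauchySeq_of_le_geometric_two fun n => hsd n y)
  have hlim : Tendsto (fun n : ℕ => (4 : ℝ) / 2 ^ n) atTop (𝓝 0) := by
    have := (tendsto_pow_atTop_nhds_zero_of_lt_one (r := (1 / 2 : ℝ)) (by norm_num)
      (by norm_num)).const_mul 4
    simpa [div_eq_mul_inv] using this
  have hunif : TendstoUniformly (fun n => (s n : Y → E)) g atTop := by
    rw [tendstoUniformly_iff]
    intro ε hε
    filter_upwards [hlim.eventually (gt_mem_nhds hε)] with n hn y
    rw [dist_comm]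
    exact (dist_le_of_le_geometric_two_of_tendsto (fun n => hsd n y) (hg y) n).trans_lt hn
  refine ⟨⟨g, hunif.continuous (Frequently.of_forall fun n => (s n).continuous)⟩, fun y => ?_⟩
  refine Metric.mem_closure_iff.2 fun ε hε => ?_
  have h1 := (tendsto_pow_atTop_nhds_zero_of_lt_one (r := (1 / 2 : ℝ)) (by norm_num)
      (by norm_num)).eventually (gt_mem_nhds (half_pos hε))
  have h2 := Metric.tendsto_nhds.1 (hg y) _ (half_pos hε)
  obtain ⟨n, hn1, hn2⟩ := (h1.and h2).exists
  obtain ⟨w, hw, hwd⟩ := mem_thickening_iff.1 (hs n y)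
  refine ⟨w, hw, ?_⟩
  have := dist_triangle_left (g y) w (s n y)
  simp only [ContinuousMap.coe_mk]
  linarith

end Selection

/-! ### Monotonicity and rigidity of the upper integral -/

section UpperIntegral

variable {T : Type*} [MeasurableSpace T] {μ : Measure T} {g g' : T → EReal}

theorem upperIntegral_mono_ae (h : g ≤ᵐ[μ] g') : upperIntegral μ g ≤ upperIntegral μ g' := by
  have h1 : ∫⁻ t, (g t).toENNReal ∂μ ≤ ∫⁻ t, (g' t).toENNReal ∂μ :=
    lintegral_mono_ae (h.mono fun t ht => EReal.toENNReal_le_toENNReal ht)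
  have h2 : ∫⁻ t, (-g' t).toENNReal ∂μ ≤ ∫⁻ t, (-g t).toENNReal ∂μ :=
    lintegral_mono_ae (h.mono fun t ht => EReal.toENNReal_le_toENNReal (EReal.neg_le_neg_iff.2 ht))
  unfold upperIntegral
  split_ifs with h3 h4 h4
  · exact le_rfl
  · exact absurd (top_le_iff.1 (h3 ▸ h1)) h4
  · exact le_top
  · exact EReal.sub_le_sub (by exact_mod_cast h1) (by exact_mod_cast h2)

/-- Two comparable measurable functions with the same finite upper integral agree almost
everywhere. -/
theorem ae_eq_of_upperIntegral_le (hg : Measurable g) (hg' : Measurable g') (h : g' ≤ g)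
    (hbot : ⊥ < upperIntegral μ g) (htop : upperIntegral μ g < ⊤)
    (hle : upperIntegral μ g ≤ upperIntegral μ g') : g' =ᵐ[μ] g := by
  have h1 : ∀ t, (g' t).toENNReal ≤ (g t).toENNReal :=
    fun t => EReal.toENNReal_le_toENNReal (h t)
  have h2 : ∀ t, (-g t).toENNReal ≤ (-g' t).toENNReal :=
    fun t => EReal.toENNReal_le_toENNReal (EReal.neg_le_neg_iff.2 (h t))
  have i1 := lintegral_mono (μ := μ) h1
  have i2 := lintegral_mono (μ := μ) h2
  have hfin : ∫⁻ t, (g t).toENNReal ∂μ ≠ ∞ := by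
    intro h0
    simp [upperIntegral, h0] at htop
  have hfin' : ∫⁻ t, (g' t).toENNReal ∂μ ≠ ∞ := ne_top_of_le_ne_top hfin i1
  -- Here `a`, `b` are the integrals of the positive and negative parts of `g`, and `a'`, `b'` those
  -- of `g'`. An infinite `b'` would make the right side `⊥`; with everything finite, no inequality
  -- can be strict.
  have key : ∀ a a' b b' : ℝ≥0∞, a ≠ ∞ → a' ≤ a → b ≤ b' → (⊥ : EReal) < a - b →
      (a : EReal) - b ≤ a' - b' → b' ≠ ∞ ∧ a ≤ a' ∧ b' ≤ b := by
    intro a a' b b' ha ha' hb hbot hle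
    have hb' : b' ≠ ∞ := by
      rintro rfl
      have := hbot.trans_le hle
      simp at this
    lift a to NNReal using ha
    lift a' to NNReal using ne_top_of_le_ne_top ENNReal.coe_ne_top ha'
    lift b' to NNReal using hb'
    lift b to NNReal using ne_top_of_le_ne_top ENNReal.coe_ne_top hb
    have e : ∀ x : NNReal, ((x : ℝ≥0∞) : EReal) = ((x : ℝ) : EReal) := fun _ => rfl
    simp only [e, ← EReal.coe_sub, EReal.coe_le_coe_iff] at hle
    norm_cast at ha' hb ⊢
    simp only [← NNReal.coe_le_coe] at ha' hb ⊢
    exact ⟨ENNReal.coe_ne_top, by linarith, by linarith⟩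
  simp only [upperIntegral, hfin, hfin', if_false] at hbot hle
  obtain ⟨k1, k2, k3⟩ := key _ _ _ _ hfin i1 i2 hbot hle
  filter_upwards [ae_eq_of_ae_le_of_lintegral_le (ae_of_all μ h1) hfin'
      hg.ereal_toENNReal.aemeasurable k2,
    ae_eq_of_ae_le_of_lintegral_le (ae_of_all μ h2) (ne_top_of_le_ne_top k1 i2)
      hg'.neg.ereal_toENNReal.aemeasurable k3] with t e1 e2
  refine le_antisymm (h t) ?_
  rcases le_total 0 (g t) with hp | hn
  · rw [← EReal.coe_toENNReal hp, ← e1]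
    rcases le_total 0 (g' t) with hp' | hn'
    · rw [EReal.coe_toENNReal hp']
    · have : g t ≤ 0 := EReal.toENNReal_eq_zero_iff.1 (e1 ▸ EReal.toENNReal_of_nonpos hn')
      have h0 : g t = 0 := le_antisymm this hp
      rw [h0, neg_zero, EReal.toENNReal_zero] at e2
      have := EReal.toENNReal_eq_zero_iff.1 e2.symm
      rw [EReal.toENNReal_of_nonpos hn']
      simpa using EReal.neg_le_neg_iff.1 (by simpa using this : -g' t ≤ -0)
  · have hn' : g' t ≤ 0 := (h t).trans hn
    have := congrArg (fun x : ℝ≥0∞ => (x : EReal)) e2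
    rw [EReal.coe_toENNReal (by simpa using EReal.neg_le_neg_iff.2 hn),
      EReal.coe_toENNReal (by simpa using EReal.neg_le_neg_iff.2 hn')] at this
    exact (neg_injective this).le

end UpperIntegral

/-! ### Exhaustion by compact sets and measurability -/

section Measurability

variable {T : Type*} [MeasurableSpace T] {μ : Measure T}

/-- If every measurable set of finite measure is exhausted by sets with the property `P`, then
countably many sets with this property cover almost the whole space. -/
theorem exists_seq_measure_compl_iUnion_eq_zero [SigmaFinite μ] {P : Set T → Prop}
    (h : ∀ ε : ℝ≥0∞, 0 < ε → ∀ A : Set T, MeasurableSet A → μ A < ∞ →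
      ∃ B, P B ∧ μ (A \ B) < ε) :
    ∃ B : ℕ → Set T, (∀ n, P (B n)) ∧ μ (⋃ n, B n)ᶜ = 0 := by
  have hpos : ∀ k : ℕ, (0 : ℝ≥0∞) < (k : ℝ≥0∞)⁻¹ := fun k =>
    ENNReal.inv_pos.2 (ENNReal.natCast_ne_top k)
  choose B hP hB using fun p : ℕ × ℕ => h _ (hpos p.2) (spanningSets μ p.1)
    (measurableSet_spanningSets μ p.1) (measure_spanningSets_lt_top μ p.1)
  refine ⟨fun n => B (Nat.unpair n), fun n => hP _, ?_⟩
  have hsub : (⋃ n, B (Nat.unpair n))ᶜ ⊆ ⋃ n, spanningSets μ n \ ⋃ k, B (n, k) := by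
    intro t ht
    obtain ⟨n, hn⟩ := mem_iUnion.1 (iUnion_spanningSets μ ▸ mem_univ t)
    refine mem_iUnion.2 ⟨n, hn, fun hk => ht ?_⟩
    obtain ⟨k, hk⟩ := mem_iUnion.1 hk
    exact mem_iUnion.2 ⟨Nat.pair n k, by rwa [Nat.unpair_pair]⟩
  refine measure_mono_null hsub (measure_iUnion_null fun n => ?_)
  refine le_antisymm (ge_of_tendsto' ENNReal.tendsto_inv_nat_nhds_zero fun k => ?_) zero_le
  exact (measure_mono (sdiff_subset_sdiff_right (subset_iUnion (fun k => B (n, k)) k))).trans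
    (hB (n, k)).le

/-- The part of `S` outside all `B n` is null, hence measurable by completeness. -/
theorem measurableSet_of_forall_inter [μ.IsComplete] {B : ℕ → Set T}
    (hB : μ (⋃ n, B n)ᶜ = 0) {S : Set T} (h : ∀ n, MeasurableSet (S ∩ B n)) :
    MeasurableSet S := by
  have : S = (⋃ n, S ∩ B n) ∪ S \ ⋃ n, B n := by
    rw [← inter_iUnion, inter_union_sdiff]
  rw [this]
  refine (MeasurableSet.iUnion h).union ?_
  exact (NullMeasurableSet.of_null (measure_mono_null (fun t ht => ht.2) hB)).measurable_of_complete

theorem measurable_of_real_Iic {g : T → EReal} (h : ∀ a : ℝ, MeasurableSet {t | g t ≤ a}) :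
    Measurable g := by
  refine measurable_of_Iic fun a => ?_
  induction a with
  | top => simp
  | coe a => exact h a
  | bot =>
    have : g ⁻¹' Iic ⊥ = ⋂ n : ℕ, {t | g t ≤ ((-n : ℝ) : EReal)} := by
      ext t
      simp only [mem_preimage, mem_Iic, le_bot_iff, mem_iInter, mem_ofPred]
      refine ⟨fun h n => h ▸ bot_le, fun h => ?_⟩
      refine EReal.eq_bot_iff_forall_lt _ |>.2 fun y => ?_
      obtain ⟨n, hn⟩ := exists_nat_gt (-y)
      exact (h n).trans_lt (by exact_mod_cast (by linarith : (-n : ℝ) < y))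
    rw [this]
    exact MeasurableSet.iInter fun n => h _

variable [TopologicalSpace T] [OpensMeasurableSpace T]

/-- The points of `B` at which a lower hemicontinuous multifunction meets an open set form a
measurable set. -/
theorem measurableSet_inter_nonempty {E : Type*} [TopologicalSpace E] {G : T → Set E} {B : Set T}
    (hB : MeasurableSet B) (hG : LowerHemicontinuousOn G B) {u : Set E} (hu : IsOpen u) :
    MeasurableSet ({t | (G t ∩ u).Nonempty} ∩ B) := by
  have h := lowerHemicontinuous_iff_isOpen_inter_nonempty.1
    (lowerHemicontinuous_restrict_iff.2 hG) u hu
  have h2 := hB.subtype_image h.measurableSet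
  convert h2 using 1
  ext t
  simp [and_comm]

/-- Membership in a closed set means distance zero. The distance from a fixed point is measurable in
`t` by lower hemicontinuity; simple approximations of `z` and continuity of the distance do the
rest, without separability of `E`. -/
theorem measurableSet_mem_inter {E : Type*} [PseudoEMetricSpace E] {G : T → Set E} {B : Set T}
    (hB : MeasurableSet B) (hG : LowerHemicontinuousOn G B) (hcl : ∀ t, IsClosed (G t))
    {z : T → E} (hz : StronglyMeasurable z) : MeasurableSet ({t | z t ∈ G t} ∩ B) := by
  have h1 : ∀ p : E, Measurable fun t : B => infEDist p (G t) := fun p => by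
    refine measurable_of_Iio fun r => ?_
    have := lowerHemicontinuous_iff_isOpen_inter_nonempty.1
      (lowerHemicontinuous_restrict_iff.2 hG) (eball p r) isOpen_eball
    convert this.measurableSet using 1
    ext t
    simp [infEDist_lt_iff, Set.Nonempty, edist_comm]
  have h2 : Measurable fun t : B => infEDist (z t) (G t) := by
    refine ENNReal.measurable_of_tendsto
      (f := fun n (t : B) => infEDist (hz.approx n t) (G t)) (fun n => ?_) ?_
    · exact SimpleFunc.measurable_bind ((hz.approx n).comp _ measurable_subtype_coe)
        (fun p (t : B) => infEDist p (G t)) h1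
    · exact tendsto_pi_nhds.2 fun t =>
        (continuous_infEDist.tendsto _).comp (hz.tendsto_approx (t : T))
  convert hB.subtype_image (h2 (measurableSet_singleton 0)) using 1
  ext t
  have h3 : z t ∈ G t ↔ infEDist (z t) (G t) = 0 := by
    rw [← mem_closure_iff_infEDist_zero, (hcl t).closure_eq]
  simp [h3, and_comm]

end Measurability

/-! ### Admissible integrands -/

section Integrand

variable {T X : Type*} [NormedAddCommGroup X] {F : Set (T → X → EReal)} {f : T → X → EReal}

theorem epi_subset_of_mem
    (hf : ∀ t, epi (f t) = closure (epi fun x => ⨅ φ : F, (φ : T → X → EReal) t x))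
    {φ : T → X → EReal} (hφ : φ ∈ F) (t : T) : epi (φ t) ⊆ epi (f t) := by
  rw [hf]
  exact fun p hp => subset_closure
    ((iInf_le (fun φ : F => (φ : T → X → EReal) t p.1) ⟨φ, hφ⟩).trans hp)

theorem exists_mem_epi_inter_nonempty
    (hf : ∀ t, epi (f t) = closure (epi fun x => ⨅ φ : F, (φ : T → X → EReal) t x))
    {t : T} {u : Set (X × ℝ)} (hu : IsOpen u) (h : (epi (f t) ∩ u).Nonempty) :
    ∃ φ ∈ F, (epi (φ t) ∩ u).Nonempty := by
  obtain ⟨p, hp, hpu⟩ := h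
  rw [hf] at hp
  obtain ⟨⟨x, a⟩, hxu, hxa⟩ := mem_closure_iff.1 hp u hu hpu
  -- At `(x, a)` the infimum may equal `a` without being attained; raising `a` slightly inside `u`
  -- makes the inequality strict, so some member lies below.
  have h1 : ∀ᶠ b in 𝓝[>] a, (x, b) ∈ u := by
    have : ContinuousAt (fun b : ℝ => (x, b)) a := by fun_prop
    exact (this.eventually (hu.mem_nhds hxu)).filter_mono nhdsWithin_le_nhds
  obtain ⟨b, hbu, hab⟩ := (h1.and self_mem_nhdsWithin).exists
  have h2 : ⨅ φ : F, (φ : T → X → EReal) t x < (b : EReal) :=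
    lt_of_le_of_lt hxa (EReal.coe_lt_coe_iff.2 hab)
  obtain ⟨φ, hφ⟩ := iInf_lt_iff.1 h2
  exact ⟨φ, φ.2, (x, b), hφ.le, hbu⟩

theorem lowerHemicontinuousOn_epi [TopologicalSpace T]
    (hf : ∀ t, epi (f t) = closure (epi fun x => ⨅ φ : F, (φ : T → X → EReal) t x))
    {B : Set T} (hB : ∀ φ ∈ F, LowerHemicontinuousOn (fun t => epi (φ t)) B) :
    LowerHemicontinuousOn (fun t => epi (f t)) B := by
  refine lowerHemicontinuousOn_iff.2 fun t ht => lowerHemicontinuousWithinAt_iff.2 fun u hu h => ?_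
  obtain ⟨φ, hφ, hne⟩ := exists_mem_epi_inter_nonempty hf hu h
  filter_upwards [lowerHemicontinuousWithinAt_iff.1 (hB φ hφ t ht) u hu hne] with s hs
  exact hs.mono (inter_subset_inter_left _ (epi_subset_of_mem hf hφ s))

theorem isClosed_epi {g : X → EReal} (hg : LowerSemicontinuous g) : IsClosed (epi g) :=
  hg.isClosed_epigraph.preimage
    (continuous_fst.prodMk (continuous_coe_real_ereal.comp continuous_snd))

/-- A lower hemicontinuous convex integrand whose infimum stays below `q` on a compact set has a
continuous selection of its `q`-sublevel sets there. -/
theorem exists_stronglyMeasurable_le [MetricSpace T] [MeasurableSpace T] [OpensMeasurableSpace T]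
    [NormedSpace ℝ X] [CompleteSpace X] {φ : T → X → EReal} (hφ : ∀ t, IsConvexLsc (φ t))
    {K : Set T} (hK : IsCompact K) (hKne : K.Nonempty)
    (hlhc : LowerHemicontinuousOn (fun t => epi (φ t)) K) {q : ℝ}
    (hq : ∀ t ∈ K, (epi (φ t) ∩ {p | p.2 < q}).Nonempty) :
    ∃ y : T → X, StronglyMeasurable y ∧ IsCompact (range y) ∧ ∀ t ∈ K, φ t (y t) ≤ q := by
  have : CompactSpace K := isCompact_iff_compactSpace.1 hK
  have hopen : IsOpen {p : X × ℝ | p.2 < q} := isOpen_lt continuous_snd continuous_const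
  have hconv : Convex ℝ {p : X × ℝ | p.2 < q} :=
    (convex_Iio q).linear_preimage (LinearMap.snd ℝ X ℝ)
  obtain ⟨g, hg⟩ := exists_continuous_forall_mem_closure
    (G := fun t : K => epi (φ t) ∩ {p | p.2 < q})
    ((lowerHemicontinuous_restrict_iff.2 hlhc).inter_hasOpenCGraph (HasOpenCGraph.const hopen))
    (fun t => (hφ t).1.inter hconv) (fun t => hq t t.2)
  obtain ⟨t₀, ht₀⟩ := hKne
  -- Off `K` the value is one already taken on `K`, so the range stays compact.
  let y : T → X := Function.extend Subtype.val (fun t : K => (g t).1) fun _ => (g ⟨t₀, ht₀⟩).1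
  have hy : ∀ t : K, y t = (g t).1 := fun t => Subtype.val_injective.extend_apply _ _ _
  have hc : Continuous fun t : K => (g t).1 := by fun_prop
  have hr : range y = range fun t : K => (g t).1 := by
    refine Subset.antisymm ?_ ?_
    · rintro _ ⟨t, rfl⟩
      by_cases ht : t ∈ K
      · exact ⟨⟨t, ht⟩, (hy ⟨t, ht⟩).symm⟩
      · have ht' : ¬∃ s : K, (s : T) = t := fun ⟨s, hs⟩ => ht (hs ▸ s.2)
        have h0 : y t = (g ⟨t₀, ht₀⟩).1 := Function.extend_apply' _ _ t ht'
        exact ⟨⟨t₀, ht₀⟩, h0.symm⟩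
    · rintro _ ⟨t, rfl⟩
      exact ⟨t, hy t⟩
  refine ⟨y, ?_, hr ▸ isCompact_range hc, fun t ht => ?_⟩
  · exact (MeasurableEmbedding.subtype_coe hK.measurableSet).stronglyMeasurable_extend
      hc.stronglyMeasurable stronglyMeasurable_const
  · have h1 := closure_minimal (s := epi (φ t) ∩ {p | p.2 < q}) (t := epi (φ t) ∩ {p | p.2 ≤ q})
      (inter_subset_inter_right _ fun p (hp : p.2 < q) => show p.2 ≤ q from hp.le)
      ((isClosed_epi (hφ t).2).inter (isClosed_le continuous_snd continuous_const)) (hg ⟨t, ht⟩)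
    rw [hy ⟨t, ht⟩]
    exact le_trans h1.1 (EReal.coe_le_coe_iff.2 h1.2)

/-- The sublevel condition `f t (x t) ≤ a` says that `(x t, a)` lies in the closed set `epi (f t)`.
-/
theorem measurable_integrand_comp [TopologicalSpace T] [MeasurableSpace T]
    [OpensMeasurableSpace T] {μ : Measure T} [μ.IsComplete] {B : ℕ → Set T}
    (hBm : ∀ n, MeasurableSet (B n)) (hB : μ (⋃ n, B n)ᶜ = 0)
    (hlhc : ∀ n, LowerHemicontinuousOn (fun t => epi (f t)) (B n))
    (hcl : ∀ t, IsClosed (epi (f t))) {x : T → X} (hx : StronglyMeasurable x) :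
    Measurable fun t => f t (x t) :=
  measurable_of_real_Iic fun a => measurableSet_of_forall_inter hB fun n =>
    measurableSet_mem_inter (hBm n) (hlhc n) hcl
      (hx.prodMk (stronglyMeasurable_const (b := a)))

end Integrand

/-! ### Necessity of pointwise minimality -/

/-- A minimizer of the integral functional with finite value minimizes the integrand pointwise
almost everywhere. -/
theorem ae_isMinOn_of_isMinOn_integralFunctional
    {T : Type*} [MetricSpace T] [MeasurableSpace T] [OpensMeasurableSpace T]
    {X : Type*} [NormedAddCommGroup X] [NormedSpace ℝ X] [CompleteSpace X]
    (μ : Measure T) [SigmaFinite μ] [μ.IsComplete] [μ.InnerRegularCompactLTTop]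
    {f : T → X → EReal} (hf : IsAdmissibleIntegrand μ f)
    {L : Set (T → X)} (hL : IsDecomposable μ L) {xbar : T → X} (hxbar : xbar ∈ L)
    (hbot : ⊥ < integralFunctional μ f xbar) (htop : integralFunctional μ f xbar < ⊤)
    (hmin : IsMinOn (integralFunctional μ f) L xbar) :
    ∀ᵐ t ∂μ, IsMinOn (f t) univ (xbar t) := by
  obtain ⟨F, hLus, hconv, hepi⟩ := hf
  obtain ⟨B, hBP, hB⟩ := exists_seq_measure_compl_iUnion_eq_zero (μ := μ)
    (P := fun B => IsCompact B ∧ μ B < ∞ ∧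
      ∀ φ ∈ F, LowerHemicontinuousOn (fun t => epi (φ t)) B)
    (fun ε hε A hA hAfin => by
      obtain ⟨B, hBc, hBA, hBε, hBl⟩ := hLus ε hε A hA hAfin
      exact ⟨B, ⟨hBc, (measure_mono hBA).trans_lt hAfin, fun φ hφ => hBl ⟨φ, hφ⟩⟩, hBε⟩)
  have hlhc : ∀ n, LowerHemicontinuousOn (fun t => epi (f t)) (B n) :=
    fun n => lowerHemicontinuousOn_epi hepi (hBP n).2.2
  have hmeas : ∀ {x : T → X}, StronglyMeasurable x → Measurable fun t => f t (x t) :=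
    measurable_integrand_comp (fun n => (hBP n).1.measurableSet) hB hlhc
      (fun t => hepi t ▸ isClosed_closure)
  have hopen : ∀ q : ℝ, IsOpen {p : X × ℝ | p.2 < q} :=
    fun q => isOpen_lt continuous_snd continuous_const
  -- Countably many such sets, with the null complement of `⋃ n, B n`, cover all points where `xbar`
  -- is not a minimizer.
  have hnull : ∀ (q : ℚ) (n : ℕ), μ ({t | ((q : ℝ) : EReal) < f t (xbar t)} ∩
      ({t | (epi (f t) ∩ {p | p.2 < (q : ℝ)}).Nonempty} ∩ B n)) = 0 := by
    intro q n
    set S := {t | ((q : ℝ) : EReal) < f t (xbar t)} ∩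
      ({t | (epi (f t) ∩ {p | p.2 < (q : ℝ)}).Nonempty} ∩ B n) with hSdef
    have hS : MeasurableSet S :=
      (measurableSet_lt measurable_const (hmeas (hL.stronglyMeasurable _ hxbar))).inter
        (measurableSet_inter_nonempty (hBP n).1.measurableSet (hlhc n) (hopen q))
    have hSfin : μ S ≠ ∞ :=
      ((measure_mono fun t ht => ht.2.2).trans_lt (hBP n).2.1).ne
    by_contra hne
    obtain ⟨C, hCS, hC, hCpos⟩ :=
      hS.exists_lt_isCompact_of_ne_top hSfin (pos_iff_ne_zero.2 hne)
    -- The member `φ` depends on `t₀`, so only a neighbourhood of `t₀` in `C` is shown to be null;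
    -- compactness of `C` then suffices.
    refine hCpos.ne' (hC.measure_zero_of_nhdsWithin fun t₀ ht₀ => ?_)
    obtain ⟨φ, hφ, hφne⟩ := exists_mem_epi_inter_nonempty hepi (hopen q) (hCS ht₀).2.1
    have hφl : LowerHemicontinuousOn (fun t => epi (φ t)) C :=
      ((hBP n).2.2 φ hφ).mono fun t ht => (hCS ht).2.2
    obtain ⟨r, hr, hrU⟩ := (nhdsWithin_hasBasis nhds_basis_closedBall C).mem_iff.1
      (lowerHemicontinuousWithinAt_iff.1 (hφl t₀ ht₀) _ (hopen q) hφne)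
    set K := closedBall t₀ r ∩ C
    have hK : IsCompact K := hC.inter_left isClosed_closedBall
    refine ⟨K, (nhdsWithin_hasBasis nhds_basis_closedBall C).mem_of_mem hr, ?_⟩
    obtain ⟨y, hy, hyc, hyq⟩ := exists_stronglyMeasurable_le (hconv φ hφ) hK
      ⟨t₀, mem_closedBall_self hr.le, ht₀⟩ (hφl.mono inter_subset_right) (q := q)
      (fun t ht => hrU ht)
    have hKfin : μ K < ∞ :=
      (measure_mono fun t ht => hCS ht.2).trans_lt (lt_top_iff_ne_top.2 hSfin)
    have hmem := hL.mem xbar hxbar y hy hyc K hK.measurableSet hKfin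
    set z := Kᶜ.indicator xbar + K.indicator y with hz
    have hlt : ∀ t ∈ K, f t (z t) < f t (xbar t) := fun t ht => by
      have h1 : z t = y t := by simp [hz, ht]
      rw [h1]
      have h2 : (y t, (q : ℝ)) ∈ epi (f t) := epi_subset_of_mem hepi hφ t (hyq t ht)
      exact lt_of_le_of_lt h2 (hCS ht.2).1
    have hle : ∀ t, f t (z t) ≤ f t (xbar t) := fun t => by
      by_cases ht : t ∈ K
      · exact (hlt t ht).le
      · simp [hz, ht]
    -- Optimality of `xbar` and `f t (z t) ≤ f t (xbar t)` force equality almost everywhere, whereas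
    -- the inequality is strict on `K`.
    have hae := ae_eq_of_upperIntegral_le (hmeas (hL.stronglyMeasurable _ hxbar))
      (hmeas (hL.stronglyMeasurable _ hmem)) hle hbot htop (hmin hmem)
    exact measure_mono_null (fun t ht => (hlt t ht).ne) (ae_iff.1 hae)
  refine ae_iff.2 (measure_mono_null (t := (⋃ n, B n)ᶜ ∪ ⋃ (q : ℚ) (n : ℕ),
    ({t | ((q : ℝ) : EReal) < f t (xbar t)} ∩
      ({t | (epi (f t) ∩ {p | p.2 < (q : ℝ)}).Nonempty} ∩ B n))) ?_ (measure_union_null hB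
    (measure_iUnion_null fun q => measure_iUnion_null (hnull q))))
  intro t ht
  by_cases htB : t ∈ ⋃ n, B n
  · obtain ⟨n, hn⟩ := mem_iUnion.1 htB
    obtain ⟨x, hx⟩ : ∃ x, f t x < f t (xbar t) := by
      by_contra! h
      exact ht fun x _ => h x
    obtain ⟨q, hxq, hq⟩ := EReal.lt_iff_exists_rat_btwn.1 hx
    obtain ⟨b, hxb, hbq⟩ := EReal.lt_iff_exists_real_btwn.1 hxq
    exact Or.inr (mem_iUnion₂.2 ⟨q, n, hq, ⟨(x, b), hxb.le, EReal.coe_lt_coe_iff.1 hbq⟩, hn⟩)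
  · exact Or.inl htB

end IntegralFunctional

theorem mainTheorem12
    {T : Type*} [MetricSpace T] [MeasurableSpace T] [OpensMeasurableSpace T]
    {X : Type*} [NormedAddCommGroup X] [NormedSpace ℝ X] [CompleteSpace X]
    (μ : Measure T) [SigmaFinite μ] [μ.IsComplete] [μ.InnerRegularCompactLTTop]
    (f : T → X → EReal) (hf : IntegralFunctional.IsAdmissibleIntegrand μ f)
    (L : Set (T → X)) (hL : IntegralFunctional.IsDecomposable μ L)
    (hu : ∃ u ∈ L, IntegralFunctional.integralFunctional μ f u < ⊤)
    (xbar : T → X) (hxbar : xbar ∈ L) :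
    ((∀ᵐ t ∂μ, IsMinOn (f t) univ (xbar t)) →
      IsMinOn (IntegralFunctional.integralFunctional μ f) L xbar) ∧
    (⊥ < IntegralFunctional.integralFunctional μ f xbar →
      (IsMinOn (IntegralFunctional.integralFunctional μ f) L xbar ↔
        ∀ᵐ t ∂μ, IsMinOn (f t) univ (xbar t))) := by
  have h1 : (∀ᵐ t ∂μ, IsMinOn (f t) univ (xbar t)) →
      IsMinOn (IntegralFunctional.integralFunctional μ f) L xbar := fun h x _ =>
    IntegralFunctional.upperIntegral_mono_ae (h.mono fun t ht => ht (mem_univ (x t)))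
  refine ⟨h1, fun hbot => ⟨fun hmin => ?_, h1⟩⟩
  obtain ⟨u, huL, hu⟩ := hu
  exact IntegralFunctional.ae_isMinOn_of_isMinOn_integralFunctional μ hf hL hxbar hbot
    ((hmin huL).trans_lt hu) hmin
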